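/- **Setting.** Let $Z\subseteq\mathbb R^n$ be a convex set and let $f:\mathbb R^n\to\mathbb R\cup\{+\infty\}$ be a convex function with $Z\subseteq\operatorname{Dom} f$, such that the sublevel sets $\{z\in Z: f(z)\le c\}$, $c\in\mathbb R$, are closed (for example, $Z$ is closed and $f$ is lower semicontinuous on $Z$). For a scenario $\xi=(h,T)\in\mathbb R^m\times\mathbb R^{m\times n}$ put $$Q(z,\xi)=\min\{q^\top y : Wy=h-Tz,\ y\ge 0\},\qquad G(z,\xi)=f(z)+Q(z,\xi),$$ where the matrix $W\in\mathbb R^{m\times r}$ and the vector $q\in\mathbb R^r$ are fixed. Assume: 1. $Z$ is non-empty and the relative interior of $\operatorname{Dom} f$ is non-empty; 2. the dual feasible set $U=\{u\in\mathbb R^m: W^\top u\le q\}$ is non-empty and bounded; 3. for every scenario $\xi$, the problem $\min_{z\in Z}G(z,\xi)$ has a unique optimal solution, denoted $z_D^*(\xi)$. Let $(X_1,\xi_1),(X_2,\xi_2),\dots$ be i.i.d. copies of a random pair $(X,\xi)$, where $X$ takes values in $\mathbb R^s$ and has support $\mathcal X$, and $\xi$ is a random scenario. Let $\Theta\subseteq\mathbb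 R^k$, and let the forecast function $\Psi$ map $(\theta,x)$ to a scenario $\Psi(\theta,x)$. For $N\ge 1$ let $\theta_N^*$ be a solution of the sample bilevel problem $$\min_{\theta\in\Theta}\ \frac1N\sum_{i=1}^N G\big(z_D^*(\hat\xi_i),\xi_i\big)\quad\text{s.t.}\quad \hat\xi_i=\Psi(\theta,X_i),\quad z_D^*(\hat\xi_i)=\operatorname*{argmin}_{z\in Z}G(z,\hat\xi_i),\qquad i=1,\dots,N.$$ Finally let $$S^*=\operatorname*{argmin}_{\theta\in\Theta}\ \mathbb E\big[G\big(z_D^*(\Psi(\theta,X)),\xi\big)\big]$$ be the set of parameters that minimize the true expected cost (a number in $(-\infty,+\infty]$) of the policy $x\mapsto z_D^*(\Psi(\theta,x))$. **Theorem 2.** Suppose in addition that $\Psi$ is jointly continuous on $\Theta\times\mathcal X$, $\xi$ is integrable, $Z$ is bounded, and $\Theta$ is compact and non-empty. Then $S^*$ is non-empty and, with probability 1, the sample bilevel problem has a solution for every $N\ge1$ and, for every choice of solutions $\theta_N^*$, $$\lim_{N\to\infty} d(\theta_N^*,S^*)=0,$$ where $d$ is the Euclidean distance from a point to a set. -/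

import Mathlib

open MeasureTheory ProbabilityTheory Filter Topology
open scoped Matrix ENNReal

/-- A scenario `ξ = (h, T)`: a right-hand side `h ∈ ℝ^m` and a technology matrix `T ∈ ℝ^{m × n}`
(written as a function of its entries, so that it carries the usual topology, Borel σ-algebra and a
norm). -/
abbrev Scenario (m n : ℕ) : Type := (Fin m → ℝ) × (Fin m → Fin n → ℝ)

/-- The data of a two-stage program with fixed recourse and fixed costs: first stage
`min_{z ∈ Z} f z + E[Q(z, ξ)]`, second stage `Q(z, ξ) = min {q ⬝ y | W y = h - T z, y ≥ 0}`.
A convex function that may take the value `+∞` is given by its effective domain `domf` and by its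
(finite) values on `domf`; the values of `f` outside `domf` are irrelevant. -/
structure TwoStage (n m r : ℕ) where
  /-- first-stage feasible set -/
  Z : Set (Fin n → ℝ)
  /-- effective domain of the first-stage cost -/
  domf : Set (Fin n → ℝ)
  /-- first-stage cost -/
  f : (Fin n → ℝ) → ℝ
  /-- recourse matrix -/
  W : Matrix (Fin m) (Fin r) ℝ
  /-- second-stage cost vector -/
  q : Fin r → ℝ

namespace TwoStage

variable {n m r : ℕ} (P : TwoStage n m r)

/-- Feasible set of the second-stage problem. -/
def recourse (z : Fin n → ℝ) (ξ : Scenario m n) : Set (Fin r → ℝ) :=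
  {y | P.W *ᵥ y = ξ.1 - Matrix.of ξ.2 *ᵥ z ∧ 0 ≤ y}

/-- Second-stage optimal value. When the dual feasible set is non-empty and bounded, the
second-stage problem is feasible and bounded for all `z` and `ξ`, and this infimum is an attained
minimum. -/
noncomputable def Q (z : Fin n → ℝ) (ξ : Scenario m n) : ℝ :=
  sInf ((fun y => P.q ⬝ᵥ y) '' P.recourse z ξ)

/-- Total cost `G(z, ξ) = f(z) + Q(z, ξ)` of the decision `z` under the scenario `ξ`. -/
noncomputable def G (z : Fin n → ℝ) (ξ : Scenario m n) : ℝ := P.f z + P.Q z ξ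

/-- Feasible set `U = {u | Wᵀ u ≤ q}` of the dual of the second-stage problem. -/
def U : Set (Fin m → ℝ) := {u | P.Wᵀ *ᵥ u ≤ P.q}

/-- Optimal solutions of the one-scenario problem `min_{z ∈ Z} G(z, ξ)`. -/
def oneScenarioArgmin (ξ : Scenario m n) : Set (Fin n → ℝ) :=
  {z | z ∈ P.Z ∧ ∀ z' ∈ P.Z, P.G z ξ ≤ P.G z' ξ}

/-- `z_D^*(ξ)`, the optimal solution of the one-scenario problem
(meaningful when that solution exists and is unique). -/
noncomputable def zD (ξ : Scenario m n) : Fin n → ℝ :=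
  Classical.epsilon fun z => z ∈ P.oneScenarioArgmin ξ

/-- The standing convexity conventions: `Z` is convex, `f` is convex with effective domain `domf`,
and `Z ⊆ dom f`. -/
def IsConvexProgram : Prop := Convex ℝ P.Z ∧ ConvexOn ℝ P.domf P.f ∧ P.Z ⊆ P.domf

/-- `Z` is non-empty and the relative interior of `dom f` is non-empty. -/
def FirstStageRegular : Prop := P.Z.Nonempty ∧ (intrinsicInterior ℝ P.domf).Nonempty

/-- The dual feasible set of the second stage is non-empty and bounded. -/
def DualBounded : Prop := P.U.Nonempty ∧ Bornology.IsBounded P.U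

/-- Every one-scenario problem has a unique optimal solution. -/
def UniqueOneScenario : Prop := ∀ ξ : Scenario m n, ∃! z, z ∈ P.oneScenarioArgmin ξ

/-- The first-stage problem is closed: all sublevel sets of `f` on `Z` are closed, i.e. `f`, set to
`+∞` outside `Z`, is lower semicontinuous. -/
def IsClosedProgram : Prop := ∀ c : ℝ, IsClosed {z | z ∈ P.Z ∧ P.f z ≤ c}

/-- The feasible points `(θ, ξ̂, z)` of the sample bilevel problem with contexts `x 0, …, x (N-1)`:
`θ ∈ Θ`, `ξ̂ i = Ψ(θ, x i)` and `z i ∈ argmin_{z ∈ Z} G(z, ξ̂ i)`. -/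
def SampleFeasible {k s : ℕ} (Θ : Set (EuclideanSpace ℝ (Fin k)))
    (Ψ : EuclideanSpace ℝ (Fin k) → (Fin s → ℝ) → Scenario m n) {N : ℕ} (x : Fin N → Fin s → ℝ)
    (θ : EuclideanSpace ℝ (Fin k)) (ξhat : Fin N → Scenario m n) (z : Fin N → Fin n → ℝ) : Prop :=
  θ ∈ Θ ∧ ∀ i, ξhat i = Ψ θ (x i) ∧ z i ∈ P.oneScenarioArgmin (ξhat i)

/-- The objective `(1/N) ∑ G(z i, ξ i)` of the sample bilevel problem. -/
noncomputable def sampleCost {N : ℕ} (z : Fin N → Fin n → ℝ) (ξ : Fin N → Scenario m n) : ℝ :=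
  1 / (N : ℝ) * ∑ i, P.G (z i) (ξ i)

/-- The parameters `θ` that solve the sample bilevel problem with data `(x i, ξ i)`, `i < N`. -/
def sampleSolutions {k s : ℕ} (Θ : Set (EuclideanSpace ℝ (Fin k)))
    (Ψ : EuclideanSpace ℝ (Fin k) → (Fin s → ℝ) → Scenario m n) {N : ℕ} (x : Fin N → Fin s → ℝ)
    (ξ : Fin N → Scenario m n) : Set (EuclideanSpace ℝ (Fin k)) :=
  {θ | ∃ ξhat z, P.SampleFeasible Θ Ψ x θ ξhat z ∧
    ∀ θ' ξhat' z', P.SampleFeasible Θ Ψ x θ' ξhat' z' → P.sampleCost z ξ ≤ P.sampleCost z' ξ}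

end TwoStage

/-- Expectation in `[-∞, +∞]`: `E[g] = E[g⁺] - E[g⁻]`. It is the usual expectation when `g` is
integrable, and `+∞` when `g⁻` is integrable and `g⁺` is not. -/
noncomputable def extExpectation {Ω : Type*} [MeasurableSpace Ω] (μ : Measure Ω) (g : Ω → ℝ) :
    EReal :=
  ((∫⁻ ω, ENNReal.ofReal (g ω) ∂μ : ℝ≥0∞) : EReal) -
    ((∫⁻ ω, ENNReal.ofReal (-g ω) ∂μ : ℝ≥0∞) : EReal)

namespace TwoStage

variable {n m r : ℕ} (P : TwoStage n m r)

/-- The performance `E[G(π(X), ξ)]` of the policy `π`. -/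
noncomputable def policyCost {Ω : Type*} [MeasurableSpace Ω] (μ : Measure Ω) {s : ℕ}
    (X : Ω → Fin s → ℝ) (ξ : Ω → Scenario m n) (π : (Fin s → ℝ) → Fin n → ℝ) : EReal :=
  extExpectation μ fun ω => P.G (π (X ω)) (ξ ω)

/-- The policy `x ↦ z_D^*(Ψ(θ, x))`. -/
noncomputable def forecastPolicy {k s : ℕ}
    (Ψ : EuclideanSpace ℝ (Fin k) → (Fin s → ℝ) → Scenario m n) (θ : EuclideanSpace ℝ (Fin k)) :
    (Fin s → ℝ) → Fin n → ℝ :=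
  fun x => P.zD (Ψ θ x)

/-- `S^*`, the set of minimizers over `θ ∈ Θ` of the performance of `x ↦ z_D^*(Ψ(θ, x))`. -/
def optimalParameters {Ω : Type*} [MeasurableSpace Ω] (μ : Measure Ω) {k s : ℕ}
    (X : Ω → Fin s → ℝ) (ξ : Ω → Scenario m n) (Θ : Set (EuclideanSpace ℝ (Fin k)))
    (Ψ : EuclideanSpace ℝ (Fin k) → (Fin s → ℝ) → Scenario m n) :
    Set (EuclideanSpace ℝ (Fin k)) :=
  {θ | θ ∈ Θ ∧ ∀ θ' ∈ Θ, P.policyCost μ X ξ (P.forecastPolicy Ψ θ) ≤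
    P.policyCost μ X ξ (P.forecastPolicy Ψ θ')}

end TwoStage

/-! A bounded non-empty dual feasible set makes the recourse complete and its value Lipschitz in the
right-hand side. On bounded `Z`, `Q` is thus Lipschitz in the scenario, uniformly in `z`. So the
optimal value is Lipschitz in the scenario, and compactness of sublevel sets plus uniqueness make
`zD` continuous (`continuous_zD`). Although `f` is only lower semicontinuous, `G (zD ζ) ξ` is
jointly continuous, because `f (zD ζ)` equals the optimal value minus `Q`.

What remains is consistency of sample average minimization over a compact set
(`ae_tendsto_infDist_sampleMin`). The costs need not be integrable, so no uniform law of large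
numbers is available. Instead, a Wald-type argument is used: near a non-optimal parameter the costs
share a bounded minorant whose mean exceeds the optimal cost. The strong law for this minorant and
for one optimal parameter excludes the whole neighbourhood eventually, and finitely many
neighbourhoods suffice.

Costs become nonnegative after adding an integrable function `K * ‖ξ‖ + c` independent of the
parameter, which changes no set of minimizers. -/

theorem LinearMap.eq_dotProduct_single {m : ℕ} (f : (Fin m → ℝ) →ₗ[ℝ] ℝ) (x : Fin m → ℝ) :
    f x = (fun j => f (Pi.single j 1)) ⬝ᵥ x := by
  rw [LinearMap.pi_apply_eq_sum_univ f x]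
  refine Finset.sum_congr rfl fun j _ => ?_
  rw [smul_eq_mul, mul_comm]
  congr 2
  ext i
  simp [Pi.single_apply, eq_comm]

/-- A convex cone other than the whole finite-dimensional space lies in a closed half-space. -/
theorem exists_ne_zero_nonpos_of_cone {E : Type*} [NormedAddCommGroup E] [NormedSpace ℝ E]
    [FiniteDimensional ℝ E] {C : Set E} (hC : Convex ℝ C) (h0 : (0 : E) ∈ C)
    (hsmul : ∀ t : ℝ, 0 ≤ t → ∀ c ∈ C, t • c ∈ C) {b : E} (hb : b ∉ C) :
    ∃ f : E →ₗ[ℝ] ℝ, f ≠ 0 ∧ ∀ c ∈ C, f c ≤ 0 := by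
  by_cases hint : (interior C).Nonempty
  · obtain ⟨f, hf, hle⟩ := geometric_hahn_banach_of_nonempty_interior_point hC
      (fun h => hb (interior_subset h)) hint
    refine ⟨f.toLinearMap, fun h => hf (ContinuousLinearMap.coe_injective h), fun c hc => ?_⟩
    by_contra! hpos
    change 0 < f c at hpos
    -- The factor rescales `c` to a point of the cone where `f` equals `|f b| + 1`, above the bound
    -- `f b`.
    have h1 := hle _ (hsmul ((|f b| + 1) / f c) (by positivity) c hc)
    rw [map_smul, smul_eq_mul, div_mul_cancel₀ _ hpos.ne'] at h1
    linarith [le_abs_self (f b)]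
  · rw [hC.interior_nonempty_iff_affineSpan_eq_top] at hint
    have hlt : Submodule.span ℝ C < ⊤ := by
      refine lt_top_iff_ne_top.2 fun h => hint ?_
      rw [← SetLike.coe_set_eq, ← Set.insert_eq_of_mem h0, affineSpan_insert_zero, h]
      rfl
    obtain ⟨f, hf, hker⟩ := Submodule.exists_le_ker_of_lt_top _ hlt
    exact ⟨f, hf, fun c hc => (LinearMap.mem_ker.1 (hker (Submodule.subset_span hc))).le⟩

/-! ### Regularity of the second-stage value and of the one-scenario solution -/

namespace TwoStage

variable {n m r : ℕ} (P : TwoStage n m r)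

/-- With a non-empty bounded dual feasible set, the recourse is complete. -/
theorem exists_recourse (hP : P.DualBounded) (b : Fin m → ℝ) : ∃ y, P.W *ᵥ y = b ∧ 0 ≤ y := by
  by_contra! hb
  obtain ⟨⟨u₀, hu₀⟩, hbd⟩ := hP
  obtain ⟨f, hf, hle⟩ := exists_ne_zero_nonpos_of_cone (C := {c | ∃ y, P.W *ᵥ y = c ∧ 0 ≤ y})
    (b := b) (by
      rintro _ ⟨y, rfl, hy⟩ _ ⟨y', rfl, hy'⟩ s t hs ht -
      exact ⟨s • y + t • y', by simp [Matrix.mulVec_add, Matrix.mulVec_smul],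
        add_nonneg (smul_nonneg hs hy) (smul_nonneg ht hy')⟩)
    ⟨0, by simp, le_rfl⟩ (by
      rintro t ht _ ⟨y, rfl, hy⟩
      exact ⟨t • y, by simp [Matrix.mulVec_smul], smul_nonneg ht hy⟩)
    (by rintro ⟨y, hy, hy'⟩; exact hb y hy hy')
  -- The separating functional is a non-zero recession direction of `U`, contradicting boundedness.
  set u : Fin m → ℝ := fun j => f (Pi.single j 1) with hu
  have hu0 : u ≠ 0 := by
    refine fun h => hf (LinearMap.ext fun x => ?_)
    rw [LinearMap.eq_dotProduct_single f x, ← hu, h]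
    simp
  have hWu : P.Wᵀ *ᵥ u ≤ 0 := by
    intro j
    have h := hle _ ⟨Pi.single j 1, rfl, by simp⟩
    rw [LinearMap.eq_dotProduct_single, ← hu, Matrix.dotProduct_mulVec] at h
    simpa [Matrix.mulVec_transpose] using h
  obtain ⟨R, hR⟩ := hbd.exists_norm_le
  have hmem : ∀ t : ℝ, 0 ≤ t → u₀ + t • u ∈ P.U := by
    intro t ht j
    have h1 := hu₀ j
    have h2 := mul_nonpos_of_nonneg_of_nonpos ht (hWu j)
    simp only [Matrix.mulVec_add, Matrix.mulVec_smul, Pi.add_apply, Pi.smul_apply, smul_eq_mul]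
    linarith
  have hpos : 0 < ‖u‖ := norm_pos_iff.2 hu0
  have hR0 : 0 ≤ R := (norm_nonneg _).trans (hR _ hu₀)
  -- Two points of `U` are at distance at most `2 * R`; this step along `u` has length `2 * R + 1`.
  have h1 := hR _ (hmem ((2 * R + 1) / ‖u‖) (by positivity))
  have h2 : ‖((2 * R + 1) / ‖u‖) • u‖ = 2 * R + 1 := by
    rw [norm_smul, Real.norm_of_nonneg (by positivity), div_mul_cancel₀ _ hpos.ne']
  have h3 := norm_sub_le (u₀ + ((2 * R + 1) / ‖u‖) • u) u₀
  rw [add_sub_cancel_left, h2] at h3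
  linarith [hR _ hu₀]

/-- The optimal value of the second stage as a function of the right-hand side. -/
noncomputable def recourseValue (b : Fin m → ℝ) : ℝ :=
  sInf ((fun y => P.q ⬝ᵥ y) '' {y | P.W *ᵥ y = b ∧ 0 ≤ y})

theorem Q_eq_recourseValue (z : Fin n → ℝ) (ξ : Scenario m n) :
    P.Q z ξ = P.recourseValue (ξ.1 - Matrix.of ξ.2 *ᵥ z) := rfl

variable {P}

theorem dotProduct_le_of_mem_U {u : Fin m → ℝ} (hu : u ∈ P.U) {y : Fin r → ℝ} (hy : 0 ≤ y) :
    u ⬝ᵥ (P.W *ᵥ y) ≤ P.q ⬝ᵥ y := by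
  rw [Matrix.dotProduct_mulVec, ← Matrix.mulVec_transpose]
  exact Finset.sum_le_sum fun i _ => mul_le_mul_of_nonneg_right (hu i) (hy i)

theorem bddBelow_recourseCosts (hP : P.DualBounded) (b : Fin m → ℝ) :
    BddBelow ((fun y => P.q ⬝ᵥ y) '' {y | P.W *ᵥ y = b ∧ 0 ≤ y}) := by
  obtain ⟨u, hu⟩ := hP.1
  refine ⟨u ⬝ᵥ b, ?_⟩
  rintro _ ⟨y, ⟨rfl, hy⟩, rfl⟩
  exact dotProduct_le_of_mem_U hu hy

theorem recourseValue_le (hP : P.DualBounded) {y : Fin r → ℝ} (hy : 0 ≤ y) :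
    P.recourseValue (P.W *ᵥ y) ≤ P.q ⬝ᵥ y :=
  csInf_le (bddBelow_recourseCosts hP _) ⟨y, ⟨rfl, hy⟩, rfl⟩

theorem recourseValue_zero (hP : P.DualBounded) : P.recourseValue 0 = 0 := by
  apply le_antisymm
  · simpa using recourseValue_le hP (le_refl (0 : Fin r → ℝ))
  · obtain ⟨u, hu⟩ := hP.1
    refine le_csInf ⟨_, 0, ⟨by simp, le_rfl⟩, rfl⟩ ?_
    rintro _ ⟨y, ⟨hy, hy0⟩, rfl⟩
    simpa [hy] using dotProduct_le_of_mem_U hu hy0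

/-- Sums of nearly optimal recourses for `a` and `b` are feasible for `a + b`; attainment of the
minimum is not needed. -/
theorem recourseValue_add_le (hP : P.DualBounded) (a b : Fin m → ℝ) :
    P.recourseValue (a + b) ≤ P.recourseValue a + P.recourseValue b := by
  refine le_of_forall_pos_le_add fun ε hε => ?_
  obtain ⟨ya, hya⟩ := P.exists_recourse hP a
  obtain ⟨yb, hyb⟩ := P.exists_recourse hP b
  obtain ⟨_, ⟨y, ⟨rfl, hy⟩, rfl⟩, h1⟩ := Real.lt_sInf_add_pos
    (s := (fun y => P.q ⬝ᵥ y) '' {y | P.W *ᵥ y = a ∧ 0 ≤ y}) ⟨_, ya, hya, rfl⟩ (half_pos hε)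
  obtain ⟨_, ⟨y', ⟨rfl, hy'⟩, rfl⟩, h2⟩ := Real.lt_sInf_add_pos
    (s := (fun y => P.q ⬝ᵥ y) '' {y | P.W *ᵥ y = b ∧ 0 ≤ y}) ⟨_, yb, hyb, rfl⟩ (half_pos hε)
  have h := recourseValue_le hP (add_nonneg hy hy')
  rw [Matrix.mulVec_add, dotProduct_add] at h
  change P.q ⬝ᵥ y < P.recourseValue _ + _ at h1
  change P.q ⬝ᵥ y' < P.recourseValue _ + _ at h2
  linarith

/-- Fix a recourse for each `±e_j` and combine them with the positive and negative parts of the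
coordinates of `b` as weights. -/
theorem exists_recourseValue_le_norm (hP : P.DualBounded) :
    ∃ C, 0 ≤ C ∧ ∀ b, P.recourseValue b ≤ C * ‖b‖ := by
  choose yp hyp hyp0 using fun j : Fin m => P.exists_recourse hP (Pi.single j 1)
  choose ym hym hym0 using fun j : Fin m => P.exists_recourse hP (-Pi.single j 1)
  refine ⟨∑ j, (|P.q ⬝ᵥ yp j| + |P.q ⬝ᵥ ym j|),
    Finset.sum_nonneg fun j _ => by positivity, fun b => ?_⟩
  have hW : P.W *ᵥ (∑ j, (max (b j) 0 • yp j + max (-b j) 0 • ym j)) = b := by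
    rw [Matrix.mulVec_sum]
    simp only [Matrix.mulVec_add, Matrix.mulVec_smul, hyp, hym]
    conv_rhs => rw [← Finset.univ_sum_single b]
    refine Finset.sum_congr rfl fun j _ => ?_
    rw [smul_neg, ← sub_eq_add_neg, ← sub_smul]
    have h : max (b j) 0 - max (-b j) 0 = b j := by
      rcases le_total 0 (b j) with h | h
      · rw [max_eq_left h, max_eq_right (by linarith)]; ring
      · rw [max_eq_right h, max_eq_left (by linarith)]; ring
    rw [h]
    ext i
    simp [Pi.single_apply]
  have h0 : 0 ≤ ∑ j, (max (b j) 0 • yp j + max (-b j) 0 • ym j) :=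
    Finset.sum_nonneg fun j _ => add_nonneg (smul_nonneg (le_max_right _ _) (hyp0 j))
      (smul_nonneg (le_max_right _ _) (hym0 j))
  have h := recourseValue_le hP h0
  rw [hW] at h
  refine h.trans ?_
  rw [dotProduct_sum, Finset.sum_mul]
  refine Finset.sum_le_sum fun j _ => ?_
  rw [dotProduct_add, dotProduct_smul, dotProduct_smul, smul_eq_mul, smul_eq_mul]
  have hb : |b j| ≤ ‖b‖ := norm_le_pi_norm b j
  have h1 : max (b j) 0 ≤ ‖b‖ := max_le ((le_abs_self _).trans hb) (norm_nonneg _)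
  have h2 : max (-b j) 0 ≤ ‖b‖ := max_le ((neg_le_abs _).trans hb) (norm_nonneg _)
  have h3 : max (b j) 0 * P.q ⬝ᵥ yp j ≤ ‖b‖ * |P.q ⬝ᵥ yp j| :=
    (mul_le_mul_of_nonneg_left (le_abs_self _) (le_max_right _ _)).trans
      (mul_le_mul_of_nonneg_right h1 (abs_nonneg _))
  have h4 : max (-b j) 0 * P.q ⬝ᵥ ym j ≤ ‖b‖ * |P.q ⬝ᵥ ym j| :=
    (mul_le_mul_of_nonneg_left (le_abs_self _) (le_max_right _ _)).trans
      (mul_le_mul_of_nonneg_right h2 (abs_nonneg _))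
  linarith

/-- Subadditivity bounds the increment by the value at `a - b` or `b - a`, which grows at most
linearly. -/
theorem exists_recourseValue_lipschitz (hP : P.DualBounded) :
    ∃ C, 0 ≤ C ∧ ∀ a b, |P.recourseValue a - P.recourseValue b| ≤ C * ‖a - b‖ := by
  obtain ⟨C, hC, h⟩ := exists_recourseValue_le_norm hP
  refine ⟨C, hC, fun a b => abs_sub_le_iff.2 ⟨?_, ?_⟩⟩
  · have h1 := recourseValue_add_le hP b (a - b)
    rw [add_sub_cancel] at h1
    linarith [h (a - b)]
  · have h1 := recourseValue_add_le hP a (b - a)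
    rw [add_sub_cancel] at h1
    rw [norm_sub_rev]
    linarith [h (b - a)]

theorem continuous_Q (hP : P.DualBounded) :
    Continuous fun p : (Fin n → ℝ) × Scenario m n => P.Q p.1 p.2 := by
  obtain ⟨C, hC, h⟩ := exists_recourseValue_lipschitz hP
  have hcont : Continuous P.recourseValue := by
    refine (LipschitzWith.of_dist_le_mul (K := C.toNNReal) fun a b => ?_).continuous
    rw [Real.dist_eq, dist_eq_norm, Real.coe_toNNReal _ hC]
    exact h a b
  simp only [Q_eq_recourseValue]
  refine hcont.comp (continuous_pi fun i => ?_)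
  simp only [Pi.sub_apply, Matrix.mulVec, dotProduct, Matrix.of_apply]
  fun_prop

theorem Q_zero (hP : P.DualBounded) (z : Fin n → ℝ) : P.Q z 0 = 0 := by
  rw [Q_eq_recourseValue]
  convert recourseValue_zero hP
  ext i
  simp

/-- `Q(z, ·)` is Lipschitz, uniformly over bounded sets of decisions. -/
theorem exists_Q_lipschitz (hP : P.DualBounded) {S : Set (Fin n → ℝ)}
    (hS : Bornology.IsBounded S) :
    ∃ K, 0 ≤ K ∧ ∀ z ∈ S, ∀ ξ ξ', |P.Q z ξ - P.Q z ξ'| ≤ K * ‖ξ - ξ'‖ := by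
  obtain ⟨C, hC, h⟩ := exists_recourseValue_lipschitz hP
  obtain ⟨R, hR0, hR⟩ := hS.exists_pos_norm_le
  -- In the sup norm, each row of `h - T z` moves by at most `‖ξ - ξ'‖` through `h` and `n * R * ‖ξ
  -- - ξ'‖` through `T`.
  refine ⟨C * (1 + n * R), by positivity, fun z hz ξ ξ' => ?_⟩
  rw [Q_eq_recourseValue, Q_eq_recourseValue, mul_assoc]
  refine (h _ _).trans (mul_le_mul_of_nonneg_left ?_ hC)
  have hz' := hR z hz
  refine (pi_norm_le_iff_of_nonneg (by positivity)).2 fun i => ?_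
  have h1 : ‖ξ.1 i - ξ'.1 i‖ ≤ ‖ξ - ξ'‖ :=
    (norm_le_pi_norm (ξ.1 - ξ'.1) i).trans (norm_fst_le (ξ - ξ'))
  have h2 : ∀ j, ‖ξ.2 i j - ξ'.2 i j‖ ≤ ‖ξ - ξ'‖ := fun j =>
    ((norm_le_pi_norm ((ξ.2 - ξ'.2) i) j).trans (norm_le_pi_norm (ξ.2 - ξ'.2) i)).trans
      (norm_snd_le (ξ - ξ'))
  have h3 : ‖∑ j, (ξ.2 i j - ξ'.2 i j) * z j‖ ≤ n * (‖ξ - ξ'‖ * R) := by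
    refine (norm_sum_le_of_le _ fun j _ => ?_).trans_eq (b := ∑ _j : Fin n, ‖ξ - ξ'‖ * R) (by simp)
    rw [norm_mul]
    exact mul_le_mul (h2 j) ((norm_le_pi_norm z j).trans hz') (norm_nonneg _) (norm_nonneg _)
  have h4 : (ξ.1 - Matrix.of ξ.2 *ᵥ z - (ξ'.1 - Matrix.of ξ'.2 *ᵥ z)) i =
      (ξ.1 i - ξ'.1 i) - ∑ j, (ξ.2 i j - ξ'.2 i j) * z j := by
    simp only [Pi.sub_apply, Matrix.mulVec, dotProduct, Matrix.of_apply, sub_mul,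
      Finset.sum_sub_distrib]
    ring
  rw [h4]
  refine (norm_sub_le _ _).trans ?_
  calc _ ≤ ‖ξ - ξ'‖ + n * (‖ξ - ξ'‖ * R) := add_le_add h1 h3
    _ = _ := by ring

theorem zD_mem (hA3 : P.UniqueOneScenario) (ξ : Scenario m n) :
    P.zD ξ ∈ P.oneScenarioArgmin ξ :=
  Classical.epsilon_spec (hA3 ξ).exists

theorem eq_zD (hA3 : P.UniqueOneScenario) {ξ : Scenario m n} {z : Fin n → ℝ}
    (hz : z ∈ P.oneScenarioArgmin ξ) : z = P.zD ξ :=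
  (hA3 ξ).unique hz (zD_mem hA3 ξ)

theorem G_zD_le (hA3 : P.UniqueOneScenario) {K : ℝ}
    (hK : ∀ z ∈ P.Z, ∀ ξ ξ', |P.Q z ξ - P.Q z ξ'| ≤ K * ‖ξ - ξ'‖) (ξ ξ' : Scenario m n) :
    P.G (P.zD ξ) ξ ≤ P.G (P.zD ξ') ξ' + K * ‖ξ - ξ'‖ := by
  have h1 := (zD_mem hA3 ξ).2 _ (zD_mem hA3 ξ').1
  have h2 := (abs_le.1 (hK _ (zD_mem hA3 ξ').1 ξ ξ')).2
  unfold G at *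
  linarith

theorem continuous_G_zD_self (hP : P.DualBounded) (hA3 : P.UniqueOneScenario)
    (hZ : Bornology.IsBounded P.Z) : Continuous fun ξ => P.G (P.zD ξ) ξ := by
  obtain ⟨K, hK0, hK⟩ := exists_Q_lipschitz hP hZ
  refine (LipschitzWith.of_dist_le_mul (K := K.toNNReal) fun a b => ?_).continuous
  rw [Real.dist_eq, dist_eq_norm, Real.coe_toNNReal _ hK0, abs_sub_le_iff]
  have h1 := G_zD_le hA3 hK a b
  have h2 := G_zD_le hA3 hK b a
  rw [norm_sub_rev] at h2
  constructor <;> linarith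

/-- Along `ζ → ξ` the solutions stay in a compact sublevel set of `f`. Closedness of the sublevel
sets makes every cluster point optimal for `ξ`, and uniqueness identifies it with `zD ξ`. -/
theorem continuous_zD (hclosed : P.IsClosedProgram) (hP : P.DualBounded)
    (hA3 : P.UniqueOneScenario) (hZ : Bornology.IsBounded P.Z) : Continuous P.zD := by
  obtain ⟨K, hK0, hK⟩ := exists_Q_lipschitz hP hZ
  have hv := continuous_G_zD_self hP hA3 hZ
  refine continuous_iff_continuousAt.2 fun ξ => tendsto_of_subseq_tendsto fun ζ hζ => ?_
  have hcompact : ∀ c, IsCompact {z | z ∈ P.Z ∧ P.f z ≤ c} := fun c =>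
    Metric.isCompact_of_isClosed_isBounded (hclosed c) (hZ.subset fun z hz => hz.1)
  have hQ0 : ∀ z ∈ P.Z, ∀ ξ, |P.Q z ξ| ≤ K * ‖ξ‖ := fun z hz ξ => by
    simpa [Q_zero hP] using hK z hz ξ 0
  have hbound : Tendsto (fun j => P.G (P.zD (ζ j)) (ζ j) + K * ‖ζ j‖) atTop
      (𝓝 (P.G (P.zD ξ) ξ + K * ‖ξ‖)) :=
    ((hv.tendsto ξ).comp hζ).add (hζ.norm.const_mul K)
  have hmem : ∀ᶠ j in atTop,
      P.zD (ζ j) ∈ {z | z ∈ P.Z ∧ P.f z ≤ P.G (P.zD ξ) ξ + K * ‖ξ‖ + 1} := by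
    filter_upwards [hbound.eventually (gt_mem_nhds (lt_add_one _))] with j hj
    refine ⟨(zD_mem hA3 _).1, ?_⟩
    have h1 := (abs_le.1 (hQ0 _ (zD_mem hA3 (ζ j)).1 (ζ j))).1
    unfold G at hj ⊢
    linarith
  obtain ⟨z, hz, φ, hφ, hlim⟩ := (hcompact _).tendsto_subseq' hmem.frequently
  refine ⟨φ, ?_⟩
  have hζφ := hζ.comp hφ.tendsto_atTop
  -- Here `f` converges along the solutions, being the optimal value minus `Q`; its limit is
  -- compared with `f z` only by lower semicontinuity.
  have hf : Tendsto (fun j => P.f (P.zD (ζ (φ j)))) atTop (𝓝 (P.G (P.zD ξ) ξ - P.Q z ξ)) := by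
    have h := ((hv.tendsto ξ).comp hζφ).sub
      (((continuous_Q hP).tendsto (z, ξ)).comp (hlim.prodMk_nhds hζφ))
    refine h.congr fun j => ?_
    simp [G]
  have hfz : P.f z ≤ P.G (P.zD ξ) ξ - P.Q z ξ := by
    refine le_of_forall_pos_le_add fun ε hε => ?_
    have hcl := hclosed (P.G (P.zD ξ) ξ - P.Q z ξ + ε)
    refine (hcl.mem_of_tendsto hlim ?_).2
    filter_upwards [hf.eventually (gt_mem_nhds (lt_add_of_pos_right _ hε))] with j hj
    exact ⟨(zD_mem hA3 _).1, hj.le⟩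
  have hzarg : z ∈ P.oneScenarioArgmin ξ := by
    refine ⟨hz.1, fun z' hz' => le_trans ?_ ((zD_mem hA3 ξ).2 z' hz')⟩
    have : P.G z ξ = P.f z + P.Q z ξ := rfl
    linarith
  rw [← eq_zD hA3 hzarg]
  exact hlim

theorem continuous_G_zD (hclosed : P.IsClosedProgram) (hP : P.DualBounded)
    (hA3 : P.UniqueOneScenario) (hZ : Bornology.IsBounded P.Z) :
    Continuous fun p : Scenario m n × Scenario m n => P.G (P.zD p.1) p.2 := by
  have hz := continuous_zD hclosed hP hA3 hZ
  have h : (fun p : Scenario m n × Scenario m n => P.G (P.zD p.1) p.2) = fun p =>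
      P.G (P.zD p.1) p.1 - P.Q (P.zD p.1) p.1 + P.Q (P.zD p.1) p.2 := by
    ext p
    simp [G]
  rw [h]
  exact (((continuous_G_zD_self hP hA3 hZ).comp continuous_fst).sub
    ((continuous_Q hP).comp ((hz.comp continuous_fst).prodMk continuous_fst))).add
    ((continuous_Q hP).comp ((hz.comp continuous_fst).prodMk continuous_snd))

/-- The cost of the decision `z_D^*(ζ)` is bounded below by an affine function of `‖ξ‖`. -/
theorem exists_neg_le_G_zD (hP : P.DualBounded) (hA3 : P.UniqueOneScenario)
    (hZ : Bornology.IsBounded P.Z) :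
    ∃ K c, 0 ≤ K ∧ 0 ≤ c ∧ ∀ ζ ξ, 0 ≤ P.G (P.zD ζ) ξ + (K * ‖ξ‖ + c) := by
  obtain ⟨K, hK0, hK⟩ := exists_Q_lipschitz hP hZ
  refine ⟨K, |P.f (P.zD 0)|, hK0, abs_nonneg _, fun ζ ξ => ?_⟩
  -- In the scenario `0` the second stage costs nothing, so `zD 0` minimizes `f` over `Z`.
  have h1 := (zD_mem hA3 0).2 _ (zD_mem hA3 ζ).1
  have h2 := (abs_le.1 (hK _ (zD_mem hA3 ζ).1 ξ 0)).1
  simp only [G, Q_zero hP, sub_zero] at h1 h2 ⊢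
  linarith [neg_abs_le (P.f (P.zD 0))]

end TwoStage

/-! ### Consistency of sample average minimization -/

section Consistency

variable {E D : Type*} [PseudoMetricSpace E] [MeasurableSpace D] {ν : Measure D}
  {Θ : Set E} {φ : E → D → ℝ}

/-- Near `θ₀`, the integrands `φ θ` have a common bounded minorant whose integral is as close as one
likes to that of `φ θ₀`. -/
theorem exists_local_minorant (hΘ : TopologicalSpace.IsSeparable Θ)
    (hmeas : ∀ θ ∈ Θ, AEMeasurable (φ θ) ν) (hcont : ∀ᵐ d ∂ν, ContinuousOn (fun θ => φ θ d) Θ)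
    {θ₀ : E} (hθ₀ : θ₀ ∈ Θ) {v : ℝ≥0∞} (hv : v < ∫⁻ d, ENNReal.ofReal (φ θ₀ d) ∂ν) :
    ∃ U ∈ 𝓝 θ₀, ∃ h : D → ℝ≥0∞, AEMeasurable h ν ∧ (∃ M : ℕ, ∀ d, h d ≤ M) ∧
      (∀ᵐ d ∂ν, ∀ θ ∈ U ∩ Θ, h d ≤ ENNReal.ofReal (φ θ d)) ∧ v < ∫⁻ d, h d ∂ν := by
  obtain ⟨c, hcΘ, hc, hdense⟩ := hΘ.exists_countable_dense_subset
  let B : ℕ → Set E := fun j => Metric.ball θ₀ (1 / ((j : ℝ) + 1))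
  -- The countable dense set keeps the infimum measurable; truncation at `j` keeps it integrable,
  -- and both effects vanish as `j` grows.
  let h : ℕ → D → ℝ≥0∞ := fun j d => min (⨅ θ ∈ c ∩ B j, ENNReal.ofReal (φ θ d)) j
  have hh : ∀ j, AEMeasurable (h j) ν := fun j =>
    (AEMeasurable.biInf _ (hc.mono Set.inter_subset_left)
      fun θ hθ => (hmeas θ (hcΘ hθ.1)).ennreal_ofReal).min aemeasurable_const
  have hmono : ∀ d, Monotone fun j => h j d := fun d i j hij =>
    min_le_min (biInf_mono fun θ hθ => ⟨hθ.1, Metric.ball_subset_ball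
      (one_div_le_one_div_of_le (by positivity) (by gcongr)) hθ.2⟩) (by exact_mod_cast hij)
  have hsup : ∀ᵐ d ∂ν, ENNReal.ofReal (φ θ₀ d) ≤ ⨆ j, h j d := by
    filter_upwards [hcont] with d hd
    refine le_of_forall_lt fun a ha => ?_
    obtain ⟨b, hab, hb⟩ := exists_between ha
    have hcw : ContinuousWithinAt (fun θ => ENNReal.ofReal (φ θ d)) Θ θ₀ :=
      ENNReal.continuous_ofReal.continuousAt.comp_continuousWithinAt (hd θ₀ hθ₀)
    obtain ⟨ε, hε, hball⟩ := Metric.mem_nhdsWithin_iff.1 (hcw.eventually (lt_mem_nhds hb))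
    obtain ⟨i, hi⟩ := exists_nat_one_div_lt hε
    obtain ⟨k, hk⟩ := ENNReal.exists_nat_gt hb.ne_top
    refine hab.trans_le (le_trans ?_ (le_iSup _ (max i k)))
    refine le_min (le_iInf₂ fun θ hθ => (hball ⟨?_, hcΘ hθ.1⟩).le) (hk.le.trans ?_)
    · refine Metric.ball_subset_ball (le_trans ?_ hi.le) hθ.2
      exact one_div_le_one_div_of_le (by positivity) (by gcongr; exact le_max_left _ _)
    · exact_mod_cast le_max_right i k
  have hlt : v < ⨆ j, ∫⁻ d, h j d ∂ν := by
    rw [← lintegral_iSup' hh (ae_of_all _ hmono)]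
    exact hv.trans_le (lintegral_mono_ae hsup)
  obtain ⟨j, hj⟩ := lt_iSup_iff.1 hlt
  refine ⟨B j, Metric.ball_mem_nhds _ (by positivity), h j, hh j, ⟨j, fun d => min_le_right _ _⟩,
    ?_, hj⟩
  filter_upwards [hcont] with d hd
  rintro θ ⟨hθB, hθΘ⟩
  have hcw : Tendsto (fun θ => ENNReal.ofReal (φ θ d)) (𝓝[c ∩ B j] θ)
      (𝓝 (ENNReal.ofReal (φ θ d))) :=
    (ENNReal.continuous_ofReal.continuousAt.comp_continuousWithinAt (hd θ hθΘ)).mono_left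
      (nhdsWithin_mono _ (Set.inter_subset_left.trans hcΘ))
  -- Since the ball is open, `c` is dense in its trace on `Θ`, so by continuity the bound passes
  -- from `c` to all of `Θ` in the ball.
  have : (𝓝[c ∩ B j] θ).NeBot := by
    rw [← mem_closure_iff_nhdsWithin_neBot, Set.inter_comm]
    exact Metric.isOpen_ball.inter_closure ⟨hθB, hdense hθΘ⟩
  refine ge_of_tendsto hcw ?_
  filter_upwards [self_mem_nhdsWithin] with θ' hθ'
  exact (min_le_left _ _).trans (iInf₂_le θ' hθ')

/-- The expected cost of a continuous integrand attains its minimum over a compact set. -/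
theorem exists_forall_lintegral_le (hΘ : IsCompact Θ) (hne : Θ.Nonempty)
    (hmeas : ∀ θ ∈ Θ, AEMeasurable (φ θ) ν) (hcont : ∀ᵐ d ∂ν, ContinuousOn (fun θ => φ θ d) Θ) :
    ∃ θ ∈ Θ, ∀ θ' ∈ Θ,
      ∫⁻ d, ENNReal.ofReal (φ θ d) ∂ν ≤ ∫⁻ d, ENNReal.ofReal (φ θ' d) ∂ν := by
  have hlsc : LowerSemicontinuousOn (fun θ => ∫⁻ d, ENNReal.ofReal (φ θ d) ∂ν) Θ := by
    intro θ₀ hθ₀ v hv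
    obtain ⟨U, hU, h, -, -, hle, hlt⟩ :=
      exists_local_minorant hΘ.isSeparable hmeas hcont hθ₀ hv
    filter_upwards [mem_nhdsWithin_of_mem_nhds hU, self_mem_nhdsWithin] with θ hθU hθΘ
    refine hlt.trans_le (lintegral_mono_ae ?_)
    filter_upwards [hle] with d hd using hd θ ⟨hθU, hθΘ⟩
  obtain ⟨θ, hθ, hmin⟩ := hlsc.exists_isMinOn hne hΘ
  exact ⟨θ, hθ, fun θ' hθ' => hmin hθ'⟩

variable {Ω : Type*} [MeasurableSpace Ω] {μ : Measure Ω} {Y : ℕ → Ω → D}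

/-- The strong law of large numbers for a statistic of an i.i.d. sequence. -/
theorem strong_law_ae_comp [IsProbabilityMeasure μ] (hY : ∀ i, Measurable (Y i))
    (hindep : iIndepFun Y μ) (hident : ∀ i, IdentDistrib (Y i) (Y 0) μ μ) {g : D → ℝ}
    (hg : Integrable g (μ.map (Y 0))) :
    ∀ᵐ ω ∂μ, Tendsto (fun N : ℕ => (∑ i ∈ Finset.range N, g (Y i ω)) / N) atTop
      (𝓝 (∫ d, g d ∂μ.map (Y 0))) := by
  have hmap : ∀ i, AEMeasurable g (μ.map (Y i)) := fun i => by
    rw [(hident i).map_eq]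
    exact hg.aemeasurable
  have h := strong_law_ae_real (μ := μ) (fun i => g ∘ Y i)
    (hg.comp_measurable (hY 0))
    (fun i j hij => (hindep.indepFun hij).comp₀ (hY i).aemeasurable (hY j).aemeasurable
      (hmap i) (hmap j))
    (fun i => (hident i).comp_of_aemeasurable (hmap i))
  rw [integral_map (hY 0).aemeasurable hg.aestronglyMeasurable]
  exact h

theorem ae_forall_of_ae_map (hY : ∀ i, Measurable (Y i))
    (hident : ∀ i, IdentDistrib (Y i) (Y 0) μ μ) {p : D → Prop} (hp : ∀ᵐ d ∂μ.map (Y 0), p d) :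
    ∀ᵐ ω ∂μ, ∀ i, p (Y i ω) :=
  ae_all_iff.2 fun i => ae_of_ae_map (hY i).aemeasurable (by rwa [(hident i).map_eq])

/-- Around a parameter that is not optimal for the expected cost there are almost surely
eventually no parameters that are optimal for the sample cost. -/
theorem exists_nhds_eventually_not_sampleMin [IsProbabilityMeasure μ] (hΘ : IsCompact Θ)
    (hY : ∀ i, Measurable (Y i)) (hindep : iIndepFun Y μ)
    (hident : ∀ i, IdentDistrib (Y i) (Y 0) μ μ) (hφ : ∀ θ d, 0 ≤ φ θ d)
    (hmeas : ∀ θ ∈ Θ, AEMeasurable (φ θ) (μ.map (Y 0)))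
    (hcont : ∀ᵐ d ∂μ.map (Y 0), ContinuousOn (fun θ => φ θ d) Θ) {θ₀ θ₁ : E} (hθ₀ : θ₀ ∈ Θ)
    (hθ₁ : θ₁ ∈ Θ) (hlt : ∫⁻ d, ENNReal.ofReal (φ θ₁ d) ∂μ.map (Y 0) <
      ∫⁻ d, ENNReal.ofReal (φ θ₀ d) ∂μ.map (Y 0)) :
    ∃ U ∈ 𝓝 θ₀, ∀ᵐ ω ∂μ, ∀ᶠ N : ℕ in atTop, ∀ θ ∈ U ∩ Θ,
      ∑ i ∈ Finset.range N, φ θ₁ (Y i ω) < ∑ i ∈ Finset.range N, φ θ (Y i ω) := by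
  have : IsProbabilityMeasure (μ.map (Y 0)) :=
    Measure.isProbabilityMeasure_map (hY 0).aemeasurable
  obtain ⟨U, hU, h, hh, ⟨M, hM⟩, hle, hlt'⟩ :=
    exists_local_minorant hΘ.isSeparable hmeas hcont hθ₀ hlt
  refine ⟨U, hU, ?_⟩
  have hhtop : ∀ d, h d < ∞ := fun d => (hM d).trans_lt (ENNReal.natCast_lt_top M)
  have hint : ∫⁻ d, h d ∂μ.map (Y 0) ≠ ∞ := by
    refine ((lintegral_mono hM).trans_lt ?_).ne
    simp
  -- The strict inequality forces the cost of `θ₁` to be finite; nearby `φ θ` may have infinite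
  -- mean.
  have hφint : Integrable (φ θ₁) (μ.map (Y 0)) := by
    refine ⟨(hmeas θ₁ hθ₁).aestronglyMeasurable, ?_⟩
    rw [hasFiniteIntegral_iff_ofReal (ae_of_all _ (hφ θ₁))]
    exact hlt.trans_le le_top
  have hhint : Integrable (fun d => (h d).toReal) (μ.map (Y 0)) :=
    integrable_toReal_of_lintegral_ne_top hh hint
  have hcomp : ∫ d, φ θ₁ d ∂μ.map (Y 0) < ∫ d, (h d).toReal ∂μ.map (Y 0) := by
    rw [integral_eq_lintegral_of_nonneg_ae (ae_of_all _ (hφ θ₁)) hφint.aestronglyMeasurable,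
      integral_toReal hh (ae_of_all _ hhtop)]
    exact ENNReal.toReal_strict_mono hint hlt'
  filter_upwards [strong_law_ae_comp hY hindep hident hφint,
    strong_law_ae_comp hY hindep hident hhint, ae_forall_of_ae_map hY hident hle] with ω h1 h2 h3
  filter_upwards [h1.eventually_lt h2 hcomp, eventually_gt_atTop 0] with N hN hN0 θ hθ
  rw [div_lt_div_iff_of_pos_right (by exact_mod_cast hN0)] at hN
  refine hN.trans_le (Finset.sum_le_sum fun i _ => ?_)
  exact ENNReal.toReal_le_of_le_ofReal (hφ _ _) (h3 i θ hθ)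

/-- **Consistency of sample average minimization** for nonnegative continuous integrands, which
need not be integrable, over a compact set. -/
theorem ae_tendsto_infDist_sampleMin [IsProbabilityMeasure μ] (hΘ : IsCompact Θ)
    (hne : Θ.Nonempty)
    (hY : ∀ i, Measurable (Y i)) (hindep : iIndepFun Y μ)
    (hident : ∀ i, IdentDistrib (Y i) (Y 0) μ μ) (hφ : ∀ θ d, 0 ≤ φ θ d)
    (hmeas : ∀ θ ∈ Θ, AEMeasurable (φ θ) (μ.map (Y 0)))
    (hcont : ∀ᵐ d ∂μ.map (Y 0), ContinuousOn (fun θ => φ θ d) Θ) :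
    ∀ᵐ ω ∂μ, ∀ θ : ℕ → E, (∀ N, 1 ≤ N → θ N ∈ Θ ∧ ∀ θ' ∈ Θ,
        ∑ i ∈ Finset.range N, φ (θ N) (Y i ω) ≤ ∑ i ∈ Finset.range N, φ θ' (Y i ω)) →
      Tendsto (fun N => Metric.infDist (θ N) {θ | θ ∈ Θ ∧ ∀ θ' ∈ Θ,
        ∫⁻ d, ENNReal.ofReal (φ θ d) ∂μ.map (Y 0) ≤ ∫⁻ d, ENNReal.ofReal (φ θ' d) ∂μ.map (Y 0)})
        atTop (𝓝 0) := by
  set S : Set E := {θ | θ ∈ Θ ∧ ∀ θ' ∈ Θ,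
    ∫⁻ d, ENNReal.ofReal (φ θ d) ∂μ.map (Y 0) ≤ ∫⁻ d, ENNReal.ofReal (φ θ' d) ∂μ.map (Y 0)}
    with hS
  obtain ⟨θ₁, hθ₁, hmin⟩ := exists_forall_lintegral_le hΘ hne hmeas hcont
  -- Countably many distances `1 / (j + 1)` give a single null set that serves every choice of
  -- sample minimizers.
  have key : ∀ j : ℕ, ∀ᵐ ω ∂μ, ∀ᶠ N : ℕ in atTop,
      ∀ θ ∈ (Θ ∩ {θ | 1 / ((j : ℝ) + 1) ≤ Metric.infDist θ S}) ∩ Θ,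
      ∑ i ∈ Finset.range N, φ θ₁ (Y i ω) < ∑ i ∈ Finset.range N, φ θ (Y i ω) := by
    intro j
    have hK : IsCompact (Θ ∩ {θ | 1 / ((j : ℝ) + 1) ≤ Metric.infDist θ S}) :=
      hΘ.inter_right (isClosed_le continuous_const (Metric.continuous_infDist_pt S))
    refine hK.induction_on (p := fun s => ∀ᵐ ω ∂μ, ∀ᶠ N : ℕ in atTop, ∀ θ ∈ s ∩ Θ,
      ∑ i ∈ Finset.range N, φ θ₁ (Y i ω) < ∑ i ∈ Finset.range N, φ θ (Y i ω)) ?_ ?_ ?_ ?_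
    · simp
    · intro s t hst ht
      filter_upwards [ht] with ω hω
      filter_upwards [hω] with N hN θ hθ using hN θ ⟨hst hθ.1, hθ.2⟩
    · intro s t hs ht
      filter_upwards [hs, ht] with ω hωs hωt
      filter_upwards [hωs, hωt] with N hNs hNt θ hθ
      exact hθ.1.elim (fun h => hNs θ ⟨h, hθ.2⟩) (fun h => hNt θ ⟨h, hθ.2⟩)
    · rintro θ₀ ⟨hθ₀, hdist⟩
      have hlt : ∫⁻ d, ENNReal.ofReal (φ θ₁ d) ∂μ.map (Y 0) <
          ∫⁻ d, ENNReal.ofReal (φ θ₀ d) ∂μ.map (Y 0) := by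
        by_contra! hle
        have hmem : θ₀ ∈ S := ⟨hθ₀, fun θ' hθ' => hle.trans (hmin θ' hθ')⟩
        have hpos : 0 < 1 / ((j : ℝ) + 1) := by positivity
        rw [Set.mem_ofPred_eq, Metric.infDist_zero_of_mem hmem] at hdist
        linarith
      obtain ⟨U, hU, h⟩ := exists_nhds_eventually_not_sampleMin hΘ hY hindep hident hφ hmeas hcont
        hθ₀ hθ₁ hlt
      exact ⟨U, mem_nhdsWithin_of_mem_nhds hU, h⟩
  filter_upwards [ae_all_iff.2 key] with ω hω θ hθ
  -- The variant with strict `N > N₀` ensures `N ≥ 1`, where the minimality of `θ N` is available.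
  refine Metric.tendsto_atTop'.2 fun ε hε => ?_
  obtain ⟨j, hj⟩ := exists_nat_one_div_lt hε
  obtain ⟨N₀, hN₀⟩ := eventually_atTop.1 (hω j)
  refine ⟨N₀, fun N hN => ?_⟩
  have hθN := hθ N (by omega)
  rw [Real.dist_0_eq_abs, abs_of_nonneg Metric.infDist_nonneg]
  by_contra! hle
  exact (hθN.2 θ₁ hθ₁).not_gt (hN₀ N hN.le (θ N) ⟨⟨hθN.1, hj.le.trans hle⟩, hθN.1⟩)

end Consistency

/-! ### Extended expectations and parameter-independent shifts -/

/-- If `g` has the nonnegative integrable minorant `-b`, its extended expectation is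
`E[g + b] - E[b]`. -/
theorem extExpectation_eq_sub {Ω : Type*} [MeasurableSpace Ω] {μ : Measure Ω} {g b : Ω → ℝ}
    (hg : AEMeasurable g μ) (hb : Integrable b μ) (hb0 : ∀ ω, 0 ≤ b ω)
    (hgb : ∀ ω, 0 ≤ g ω + b ω) :
    extExpectation μ g = ((∫⁻ ω, ENNReal.ofReal (g ω + b ω) ∂μ : ℝ≥0∞) : EReal) -
      ((∫⁻ ω, ENNReal.ofReal (b ω) ∂μ : ℝ≥0∞) : EReal) := by
  have hB : ∫⁻ ω, ENNReal.ofReal (b ω) ∂μ ≠ ∞ :=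
    ((hasFiniteIntegral_iff_ofReal (ae_of_all _ hb0)).1 hb.2).ne
  have hN : ∫⁻ ω, ENNReal.ofReal (-g ω) ∂μ ≠ ∞ :=
    ne_top_of_le_ne_top hB (lintegral_mono fun ω => ENNReal.ofReal_le_ofReal (by linarith [hgb ω]))
  -- This is `g⁺ + b = (g + b) + g⁻`, free of subtraction and hence valid even if `g⁺` has infinite
  -- integral.
  have hsum : ∫⁻ ω, ENNReal.ofReal (g ω) ∂μ + ∫⁻ ω, ENNReal.ofReal (b ω) ∂μ =
      ∫⁻ ω, ENNReal.ofReal (g ω + b ω) ∂μ + ∫⁻ ω, ENNReal.ofReal (-g ω) ∂μ := by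
    rw [← lintegral_add_left' hg.ennreal_ofReal,
      ← lintegral_add_left' (f := fun ω => ENNReal.ofReal (g ω + b ω))
        (hg.add hb.aemeasurable).ennreal_ofReal]
    refine lintegral_congr fun ω => ?_
    rcases le_total 0 (g ω) with h | h
    · rw [ENNReal.ofReal_of_nonpos (neg_nonpos.2 h), add_zero, ENNReal.ofReal_add h (hb0 ω)]
    · rw [ENNReal.ofReal_of_nonpos h, zero_add,
        ← ENNReal.ofReal_add (hgb ω) (neg_nonneg.2 h)]
      congr 1
      ring
  unfold extExpectation
  generalize ∫⁻ ω, ENNReal.ofReal (g ω) ∂μ = A at *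
  generalize ∫⁻ ω, ENNReal.ofReal (b ω) ∂μ = B at *
  generalize ∫⁻ ω, ENNReal.ofReal (g ω + b ω) ∂μ = L at *
  generalize ∫⁻ ω, ENNReal.ofReal (-g ω) ∂μ = N at *
  lift B to NNReal using hB
  lift N to NNReal using hN
  by_cases hA : A = ∞
  · subst hA
    have hL : L = ∞ := by
      by_contra hL
      exact ENNReal.add_ne_top.2 ⟨hL, ENNReal.coe_ne_top⟩ (by rw [← hsum, top_add])
    subst hL
    rfl
  · have hL : L ≠ ∞ := by
      rintro rfl
      rw [top_add] at hsum
      exact ENNReal.add_ne_top.2 ⟨hA, ENNReal.coe_ne_top⟩ hsum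
    lift A to NNReal using hA
    lift L to NNReal using hL
    have h : (A : ℝ) + B = L + N := by exact_mod_cast hsum
    have h' : (A : ℝ) - N = L - B := by linarith
    simp only [EReal.coe_nnreal_eq_coe_real, ← EReal.coe_sub, h']

theorem EReal.coe_ennreal_sub_le_sub_iff {a b c : ℝ≥0∞} (hc : c ≠ ∞) :
    (a : EReal) - c ≤ b - c ↔ a ≤ b := by
  lift c to NNReal using hc
  refine ⟨fun h => ?_, fun h => EReal.sub_le_sub (EReal.coe_ennreal_le_coe_ennreal_iff.2 h) le_rfl⟩
  have h1 := add_le_add_left h ((c : ℝ≥0∞) : EReal)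
  rw [EReal.coe_nnreal_eq_coe_real, EReal.sub_add_cancel, EReal.sub_add_cancel] at h1
  exact EReal.coe_ennreal_le_coe_ennreal_iff.1 h1

/-! ### Forecast policies and the sample bilevel problem -/

namespace TwoStage

variable {n m r k s : ℕ} {P : TwoStage n m r} {Θ : Set (EuclideanSpace ℝ (Fin k))}
  {Ψ : EuclideanSpace ℝ (Fin k) → (Fin s → ℝ) → Scenario m n}

/-- Solutions of the sample bilevel problem minimize the total cost of the forecast decisions. -/
theorem mem_sampleSolutions_iff (hA3 : P.UniqueOneScenario) {N : ℕ} (hN : 1 ≤ N)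
    {x : Fin N → Fin s → ℝ} {ξ : Fin N → Scenario m n} {θ : EuclideanSpace ℝ (Fin k)} :
    θ ∈ P.sampleSolutions Θ Ψ x ξ ↔ θ ∈ Θ ∧ ∀ θ' ∈ Θ,
      ∑ i, P.G (P.zD (Ψ θ (x i))) (ξ i) ≤ ∑ i, P.G (P.zD (Ψ θ' (x i))) (ξ i) := by
  have hN' : 0 < 1 / (N : ℝ) := by positivity
  have hfeas : ∀ θ ∈ Θ, P.SampleFeasible Θ Ψ x θ (fun i => Ψ θ (x i))
      fun i => P.zD (Ψ θ (x i)) := fun θ hθ => ⟨hθ, fun i => ⟨rfl, zD_mem hA3 _⟩⟩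
  have heq : ∀ θ ξhat z, P.SampleFeasible Θ Ψ x θ ξhat z → z = fun i => P.zD (Ψ θ (x i)) := by
    rintro θ ξhat z ⟨-, h⟩
    funext i
    rw [← (h i).1]
    exact eq_zD hA3 (h i).2
  constructor
  · rintro ⟨ξhat, z, hz, hmin⟩
    refine ⟨hz.1, fun θ' hθ' => ?_⟩
    have h := hmin θ' _ _ (hfeas θ' hθ')
    rw [heq _ _ _ hz] at h
    exact le_of_mul_le_mul_left h hN'
  · rintro ⟨hθ, hmin⟩
    refine ⟨_, _, hfeas θ hθ, fun θ' ξhat' z' hz' => ?_⟩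
    rw [heq _ _ _ hz']
    exact mul_le_mul_of_nonneg_left (hmin θ' hz'.1) hN'.le

theorem continuousOn_G_forecast (hclosed : P.IsClosedProgram) (hP : P.DualBounded)
    (hA3 : P.UniqueOneScenario) (hZ : Bornology.IsBounded P.Z) {S : Set (Fin s → ℝ)}
    (hΨ : ContinuousOn (fun p : EuclideanSpace ℝ (Fin k) × (Fin s → ℝ) => Ψ p.1 p.2) (Θ ×ˢ S))
    {x : Fin s → ℝ} (hx : x ∈ S) (ξ : Scenario m n) :
    ContinuousOn (fun θ => P.G (P.zD (Ψ θ x)) ξ) Θ := by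
  have h : ContinuousOn (fun θ => Ψ θ x) Θ :=
    hΨ.comp (f := fun θ => (θ, x)) (by fun_prop) fun _ hθ => ⟨hθ, hx⟩
  exact (continuous_G_zD hclosed hP hA3 hZ).comp_continuousOn (f := fun θ => (Ψ θ x, ξ))
    (h.prodMk continuousOn_const)

theorem aemeasurable_G_forecast (hclosed : P.IsClosedProgram) (hP : P.DualBounded)
    (hA3 : P.UniqueOneScenario) (hZ : Bornology.IsBounded P.Z) {S : Set (Fin s → ℝ)}
    (hΨ : ContinuousOn (fun p : EuclideanSpace ℝ (Fin k) × (Fin s → ℝ) => Ψ p.1 p.2) (Θ ×ˢ S))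
    (hS : MeasurableSet S) {ν : Measure ((Fin s → ℝ) × Scenario m n)} (hν : ∀ᵐ d ∂ν, d.1 ∈ S)
    {θ : EuclideanSpace ℝ (Fin k)} (hθ : θ ∈ Θ) :
    AEMeasurable (fun d : (Fin s → ℝ) × Scenario m n => P.G (P.zD (Ψ θ d.1)) d.2) ν := by
  have hc : ContinuousOn (fun d : (Fin s → ℝ) × Scenario m n => P.G (P.zD (Ψ θ d.1)) d.2)
      (Prod.fst ⁻¹' S) := by
    have h : ContinuousOn (fun d : (Fin s → ℝ) × Scenario m n => Ψ θ d.1) (Prod.fst ⁻¹' S) :=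
      hΨ.comp (f := fun d : (Fin s → ℝ) × Scenario m n => (θ, d.1)) (by fun_prop)
        fun d hd => ⟨hθ, hd⟩
    have h' : ContinuousOn (fun d : (Fin s → ℝ) × Scenario m n => (Ψ θ d.1, d.2))
        (Prod.fst ⁻¹' S) := h.prodMk continuous_snd.continuousOn
    have hG := (continuous_G_zD hclosed hP hA3 hZ).comp_continuousOn h'
    exact hG
  -- Continuity is known only over `S`, which carries all the mass, so the measure may be restricted
  -- there.
  rw [← Measure.restrict_eq_self_of_ae_mem (s := Prod.fst ⁻¹' S) hν]
  exact hc.aemeasurable (measurable_fst hS)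

end TwoStage

theorem theorem2 {n m r k s : ℕ} (P : TwoStage n m r)
    (hconv : P.IsConvexProgram) (hclosed : P.IsClosedProgram)
    -- the three assumptions on the program
    (hA1 : P.FirstStageRegular) (hA2 : P.DualBounded) (hA3 : P.UniqueOneScenario)
    -- the feasibility set is bounded
    (hZ : Bornology.IsBounded P.Z)
    -- the parameter set
    (Θ : Set (EuclideanSpace ℝ (Fin k))) (hΘ : IsCompact Θ) (hΘne : Θ.Nonempty)
    -- the i.i.d. data process, with integrable `ξ`
    {Ω : Type*} [MeasurableSpace Ω] (μ : Measure Ω) [IsProbabilityMeasure μ]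
    (X : ℕ → Ω → Fin s → ℝ) (ξ : ℕ → Ω → Scenario m n)
    (hX : ∀ i, Measurable (X i)) (hξ : ∀ i, Measurable (ξ i))
    (hindep : iIndepFun (fun i ω => (X i ω, ξ i ω)) μ)
    (hident : ∀ i, IdentDistrib (fun ω => (X i ω, ξ i ω)) (fun ω => (X 0 ω, ξ 0 ω)) μ μ)
    (hint : Integrable (ξ 0) μ)
    -- the forecast function, jointly continuous on `Θ × 𝒳`, where `𝒳` is the support of `X`
    (Ψ : EuclideanSpace ℝ (Fin k) → (Fin s → ℝ) → Scenario m n)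
    (hΨ : ContinuousOn (fun p : EuclideanSpace ℝ (Fin k) × (Fin s → ℝ) => Ψ p.1 p.2)
      (Θ ×ˢ (μ.map (X 0)).support)) :
    -- the true problem is solvable
    (P.optimalParameters μ (X 0) (ξ 0) Θ Ψ).Nonempty ∧
    -- and, with probability one,
    ∀ᵐ ω ∂μ,
      -- every sample problem is solvable
      (∀ N, 1 ≤ N → (P.sampleSolutions Θ Ψ (N := N)
        (fun i => X i ω) (fun i => ξ i ω)).Nonempty) ∧
      -- and every choice of solutions converges to the set of optimal parameters
      ∀ θ : ℕ → EuclideanSpace ℝ (Fin k),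
        (∀ N, 1 ≤ N → θ N ∈ P.sampleSolutions Θ Ψ (N := N)
          (fun i => X i ω) (fun i => ξ i ω)) →
        Tendsto (fun N => Metric.infDist (θ N) (P.optimalParameters μ (X 0) (ξ 0) Θ Ψ))
          atTop (𝓝 0) := by
  obtain ⟨K, c, hK, hc, hlow⟩ := TwoStage.exists_neg_le_G_zD hA2 hA3 hZ
  set Y : ℕ → Ω → (Fin s → ℝ) × Scenario m n := fun i ω => (X i ω, ξ i ω) with hYdef
  set ν := μ.map (Y 0) with hν
  have hY : ∀ i, Measurable (Y i) := fun i => (hX i).prodMk (hξ i)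
  let b : (Fin s → ℝ) × Scenario m n → ℝ := fun d => K * ‖d.2‖ + c
  let φ : EuclideanSpace ℝ (Fin k) → (Fin s → ℝ) × Scenario m n → ℝ :=
    fun θ d => P.G (P.zD (Ψ θ d.1)) d.2 + b d
  have hφ : ∀ θ d, 0 ≤ φ θ d := fun θ d => hlow _ _
  have hsupp : ∀ᵐ d ∂ν, d.1 ∈ (μ.map (X 0)).support := by
    have h : ∀ᵐ x ∂μ.map (X 0), x ∈ (μ.map (X 0)).support := Measure.support_mem_ae
    have hmap : μ.map (X 0) = ν.map Prod.fst := by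
      rw [hν, Measure.map_map measurable_fst (hY 0)]
      rfl
    rw [hmap] at h ⊢
    exact ae_of_ae_map measurable_fst.aemeasurable h
  have hcontG : ∀ d : (Fin s → ℝ) × Scenario m n, d.1 ∈ (μ.map (X 0)).support →
      ContinuousOn (fun θ => P.G (P.zD (Ψ θ d.1)) d.2) Θ := fun d hd =>
    TwoStage.continuousOn_G_forecast hclosed hA2 hA3 hZ hΨ hd d.2
  have hcont : ∀ᵐ d ∂ν, ContinuousOn (fun θ => φ θ d) Θ := by
    filter_upwards [hsupp] with d hd using (hcontG d hd).add continuousOn_const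
  have hb : Measurable b := by fun_prop
  have hmeasG : ∀ θ ∈ Θ, AEMeasurable (fun d : (Fin s → ℝ) × Scenario m n =>
      P.G (P.zD (Ψ θ d.1)) d.2) ν := fun θ hθ =>
    TwoStage.aemeasurable_G_forecast hclosed hA2 hA3 hZ hΨ
      Measure.isClosed_support.measurableSet hsupp hθ
  have hmeas : ∀ θ ∈ Θ, AEMeasurable (φ θ) ν := fun θ hθ => (hmeasG θ hθ).add hb.aemeasurable
  have hbint : Integrable (fun ω => b (Y 0 ω)) μ :=
    (hint.norm.const_mul K).add (integrable_const c)
  have hb0 : ∀ d, 0 ≤ b d := fun d => by positivity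
  have hBtop : ∫⁻ ω, ENNReal.ofReal (b (Y 0 ω)) ∂μ ≠ ∞ :=
    ((hasFiniteIntegral_iff_ofReal (ae_of_all _ fun ω => hb0 _)).1 hbint.2).ne
  have hcost : ∀ θ ∈ Θ, P.policyCost μ (X 0) (ξ 0) (P.forecastPolicy Ψ θ) =
      ((∫⁻ d, ENNReal.ofReal (φ θ d) ∂ν : ℝ≥0∞) : EReal) -
        ((∫⁻ ω, ENNReal.ofReal (b (Y 0 ω)) ∂μ : ℝ≥0∞) : EReal) := by
    intro θ hθ
    rw [hν, lintegral_map' (hmeas θ hθ).ennreal_ofReal (hY 0).aemeasurable]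
    exact extExpectation_eq_sub ((hmeasG θ hθ).comp_aemeasurable (hY 0).aemeasurable) hbint
      (fun ω => hb0 _) (fun ω => hφ θ (Y 0 ω))
  have hS : P.optimalParameters μ (X 0) (ξ 0) Θ Ψ = {θ | θ ∈ Θ ∧ ∀ θ' ∈ Θ,
      ∫⁻ d, ENNReal.ofReal (φ θ d) ∂ν ≤ ∫⁻ d, ENNReal.ofReal (φ θ' d) ∂ν} := by
    ext θ
    refine and_congr_right fun hθ => forall₂_congr fun θ' hθ' => ?_
    rw [hcost θ hθ, hcost θ' hθ', EReal.coe_ennreal_sub_le_sub_iff hBtop]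
  rw [hS]
  refine ⟨exists_forall_lintegral_le hΘ hΘne hmeas hcont, ?_⟩
  -- Almost surely every `X i ω` lies in the support, so each sample cost is continuous on `Θ`.
  filter_upwards [ae_tendsto_infDist_sampleMin hΘ hΘne hY hindep hident hφ hmeas hcont,
    ae_forall_of_ae_map hY hident hsupp] with ω hlim hω
  refine ⟨fun N hN => ?_, fun θ hθ => hlim θ fun N hN => ?_⟩
  · obtain ⟨θ, hθ, hmin⟩ := hΘ.exists_isMinOn hΘne
      (continuousOn_finsetSum Finset.univ fun (i : Fin N) _ => hcontG (Y i ω) (hω i))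
    exact ⟨θ, (TwoStage.mem_sampleSolutions_iff hA3 hN).2 ⟨hθ, fun θ' hθ' => hmin hθ'⟩⟩
  · obtain ⟨hθN, hmin⟩ := (TwoStage.mem_sampleSolutions_iff hA3 hN).1 (hθ N hN)
    refine ⟨hθN, fun θ' hθ' => ?_⟩
    -- The sum of `b` over the sample is common to both sides.
    simp only [φ, Finset.sum_add_distrib]
    refine add_le_add ?_ le_rfl
    have h := hmin θ' hθ'
    rwa [Fin.sum_univ_eq_sum_range (fun i => P.G (P.zD (Ψ (θ N) (X i ω))) (ξ i ω)),
      Fin.sum_univ_eq_sum_range (fun i => P.G (P.zD (Ψ θ' (X i ω))) (ξ i ω))] at h
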